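/- Let $k$ be a field and let $A=\bigoplus_{i\ge 0}A_i$ be a connected graded $k$-algebra (that is, $A_0=k$). Consider the category of $\mathbb Z$-graded right $A$-modules with degree-preserving homomorphisms, and write $M(j)$ for the twist with $M(j)_i=M_{i+j}$. A graded module $M$ is called finitely generated if it is a quotient of a finite direct sum of modules $A(j)$, $j\in\mathbb Z$; it is called coherent if it is finitely generated and for every homomorphism $f\colon P\to M$ from a finite direct sum $P$ of modules $A(j)$ the kernel $\ker f$ is finitely generated. The graded algebra $A$ is called (right) coherent if all the modules $A(j)$ and all the one-dimensional modules $S_j$ (equal to $k$ in degree $j$ and to $0$ in the other degrees), $j\in\mathbb Z$, are coherent. For a coherent $A$ let $\operatorname{coh}A$ be the abelian category of coherent graded modules, let $\operatorname{coh}^bA$ be its Serre subcategory of modules with only finitely many non-zero components, and let $\operatorname{cohproj}A=\operatorname{coh}A/\operatorname{coh}^bA$ be the quotient category. Assume that $A$ is coherent and is generated by $A_1$ as a $k$-algebra. Let $n>0$, and let $A^{(n)}=\bigoplus_{i\ge 0}A_{in}$ be the Veronese subalgebra, graded by $(A^{(n)})_i=A_{in}$. Then the graded algebra $A^{(n)}$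 is coherent, and there is an equivalence of categories $\operatorname{cohproj}A\simeq\operatorname{cohproj}A^{(n)}$. -/

import Mathlib

open CategoryTheory DirectSum

universe u v

namespace GradedCoherence

/-- `A = ⨁_{i ≥ 0} A_i` is connected: `A ≠ 0` and `A_0 = k`. -/
structure IsConnected {k : Type u} [Field k] {A : Type v} [Ring A] [Algebra k A]
    (𝒜 : ℕ → Submodule k A) : Prop where
  nontrivial : Nontrivial A
  eq_scalar : ∀ a ∈ 𝒜 0, ∃ c : k, algebraMap k A c = a

/-- `A` is generated, as a `k`-algebra, by its component of degree one. -/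
def IsGeneratedInDegreeOne {k : Type u} [Field k] {A : Type v} [Ring A] [Algebra k A]
    (𝒜 : ℕ → Submodule k A) : Prop :=
  Algebra.adjoin k (𝒜 1 : Set A) = ⊤

section Modules

variable {k : Type u} [Field k] {A : Type v} [Ring A] [Algebra k A]

/-- A `ℤ`-graded right module `M = ⨁_{i ∈ ℤ} M_i` over the graded algebra `A = ⨁_{j ≥ 0} A_j`,
given by its homogeneous components and the action maps `M_i ⊗ A_j → M_{i+j}`. (The index `l`
with `i + j = l` avoids transport along equalities of degrees.) -/
structure GrMod (𝒜 : ℕ → Submodule k A) [GradedAlgebra 𝒜] where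
  carrier : ℤ → Type v
  [addCommGroup : ∀ i, AddCommGroup (carrier i)]
  [module : ∀ i, Module k (carrier i)]
  act : ∀ {i : ℤ} {j : ℕ} {l : ℤ}, i + j = l → carrier i →ₗ[k] 𝒜 j →ₗ[k] carrier l
  act_one : ∀ {i : ℤ} (h : i + (0 : ℕ) = i) (x : carrier i),
    act h x ⟨1, SetLike.GradedOne.one_mem⟩ = x
  act_mul : ∀ {i l m : ℤ} {j j' : ℕ} (h : i + j = l) (h' : l + j' = m)
    (h'' : i + (j + j' : ℕ) = m) (x : carrier i) (a : 𝒜 j) (b : 𝒜 j'),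
    act h' (act h x a) b = act h'' x ⟨a * b, SetLike.GradedMul.mul_mem a.2 b.2⟩

attribute [instance] GrMod.addCommGroup GrMod.module

variable {𝒜 : ℕ → Submodule k A} [GradedAlgebra 𝒜]

namespace GrMod

/-- Homomorphisms of graded right modules (they preserve degrees). -/
@[ext]
structure Hom (M N : GrMod 𝒜) where
  app : ∀ i : ℤ, M.carrier i →ₗ[k] N.carrier i
  app_act : ∀ {i : ℤ} {j : ℕ} {l : ℤ} (h : i + j = l) (x : M.carrier i) (a : 𝒜 j),
    app l (M.act h x a) = N.act h (app i x) a

/-- The category `GR A` of graded right modules. -/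
instance : Category (GrMod 𝒜) where
  Hom M N := Hom M N
  id M := { app := fun _ => LinearMap.id, app_act := fun _ _ _ => rfl }
  comp f g :=
    { app := fun i => (g.app i).comp (f.app i)
      app_act := fun h x a => by simp [f.app_act, g.app_act] }

/-- The twist `M(d)`, with `M(d)_i = M_{i+d}`. -/
def twist (M : GrMod 𝒜) (d : ℤ) : GrMod 𝒜 where
  carrier i := M.carrier (i + d)
  act h := M.act (by omega)
  act_one _ x := M.act_one (by omega) x
  act_mul _ _ _ x a b := M.act_mul (by omega) (by omega) (by omega) x a b

/-- The finite direct sum `M_0 ⊕ ⋯ ⊕ M_{s-1}`. -/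
def finSum {s : ℕ} (M : Fin s → GrMod 𝒜) : GrMod 𝒜 where
  carrier i := ∀ t : Fin s, (M t).carrier i
  act h := LinearMap.mk₂ k (fun x a t => (M t).act h (x t) a)
    (fun _ _ _ => by ext; simp) (fun _ _ _ => by ext; simp)
    (fun _ _ _ => by ext; simp) (fun _ _ _ => by ext; simp)
  act_one h x := by ext t; exact (M t).act_one h (x t)
  act_mul h h' h'' x a b := by ext t; exact (M t).act_mul h h' h'' (x t) a b

/-- The kernel of a homomorphism, with components `ker (M_i → N_i)`. -/
def ker {M N : GrMod 𝒜} (f : M ⟶ N) : GrMod 𝒜 where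
  carrier i := LinearMap.ker (f.app i)
  act {i j l} h := LinearMap.mk₂ k
    (fun x a => ⟨M.act h x.1 a, by
      have hx : f.app i x.1 = 0 := x.2
      rw [LinearMap.mem_ker, f.app_act, hx, map_zero, LinearMap.zero_apply]⟩)
    (fun _ _ _ => by ext; simp) (fun _ _ _ => by ext; simp)
    (fun _ _ _ => by ext; simp) (fun _ _ _ => by ext; simp)
  act_one h x := Subtype.ext (M.act_one h x.1)
  act_mul h h' h'' x a b := Subtype.ext (M.act_mul h h' h'' x.1 a b)

/-- The cokernel of a homomorphism, with components `N_i / im (M_i → N_i)`. -/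
def coker {M N : GrMod 𝒜} (f : M ⟶ N) : GrMod 𝒜 where
  carrier i := N.carrier i ⧸ LinearMap.range (f.app i)
  act {i j l} h := LinearMap.flip
    { toFun := fun a => Submodule.mapQ _ _ ((N.act h).flip a) (by
        rintro _ ⟨x, rfl⟩
        exact ⟨M.act h x a, f.app_act h x a⟩)
      map_add' := fun a b => by
        apply Submodule.linearMap_qext
        ext x
        simp
      map_smul' := fun c a => by
        apply Submodule.linearMap_qext
        ext x
        simp }
  act_one h x := by
    obtain ⟨y, rfl⟩ := Submodule.Quotient.mk_surjective _ x
    exact congrArg (Submodule.Quotient.mk (p := LinearMap.range (f.app _))) (N.act_one h y)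
  act_mul h h' h'' x a b := by
    obtain ⟨y, rfl⟩ := Submodule.Quotient.mk_surjective _ x
    exact congrArg (Submodule.Quotient.mk (p := LinearMap.range (f.app _)))
      (N.act_mul h h' h'' y a b)

variable (𝒜) in
/-- The component of degree `m ∈ ℤ` of `A`, namely `A_m` for `m ≥ 0` and `0` for `m < 0`. -/
def comp : ℤ → Submodule k A
  | Int.ofNat m => 𝒜 m
  | Int.negSucc _ => ⊥

theorem mul_mem_comp {i l : ℤ} {j : ℕ} (h : i + j = l) {x a : A} (hx : x ∈ comp 𝒜 i)
    (ha : a ∈ 𝒜 j) : x * a ∈ comp 𝒜 l := by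
  subst h
  cases i with
  | ofNat m => exact SetLike.GradedMul.mul_mem (A := 𝒜) hx ha
  | negSucc m =>
    have hx0 : x = 0 := hx
    rw [hx0, zero_mul]
    exact Submodule.zero_mem _

variable (𝒜) in
/-- `A` as a graded right module over itself. -/
def regular : GrMod 𝒜 where
  carrier i := comp 𝒜 i
  act h := LinearMap.mk₂ k (fun x a => ⟨x.1 * a.1, mul_mem_comp h x.2 a.2⟩)
    (fun _ _ _ => by ext; simp [add_mul]) (fun _ _ _ => by ext; simp)
    (fun _ _ _ => by ext; simp [mul_add]) (fun _ _ _ => by ext; simp)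
  act_one _ x := Subtype.ext (mul_one x.1)
  act_mul _ _ _ x a b := Subtype.ext (mul_assoc x.1 a.1 b.1)

variable (𝒜) in
/-- The finite direct sum `A(d_0) ⊕ ⋯ ⊕ A(d_{s-1})` of twists of `A`. -/
def free {s : ℕ} (d : Fin s → ℤ) : GrMod 𝒜 :=
  finSum fun t => (regular 𝒜).twist (d t)

variable (𝒜) in
/-- The component of degree `i` of the simple module concentrated in degree `j`. -/
def simpleComp (j i : ℤ) : Submodule k A := if i = j then 𝒜 0 else ⊥

theorem proj_mul_mem_simpleComp {j₀ i l : ℤ} {j : ℕ} (h : i + j = l) {x a : A}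
    (hx : x ∈ simpleComp 𝒜 j₀ i) (ha : a ∈ 𝒜 j) :
    GradedAlgebra.proj 𝒜 0 (x * a) ∈ simpleComp 𝒜 j₀ l := by
  unfold simpleComp at hx ⊢
  rw [GradedAlgebra.proj_apply]
  split_ifs with hl
  · exact SetLike.coe_mem _
  · rw [Submodule.mem_bot]
    split_ifs at hx with hi
    · have hj : j ≠ 0 := by rintro rfl; apply hl; omega
      have hxa : x * a ∈ 𝒜 (0 + j) := SetLike.GradedMul.mul_mem hx ha
      rw [zero_add] at hxa
      exact decompose_of_mem_ne 𝒜 hxa hj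
    · rw [Submodule.mem_bot] at hx
      simp [hx]

theorem proj_eq_of_mem_simpleComp {j₀ i : ℤ} {x : A} (hx : x ∈ simpleComp 𝒜 j₀ i) :
    GradedAlgebra.proj 𝒜 0 x = x := by
  unfold simpleComp at hx
  rw [GradedAlgebra.proj_apply]
  split_ifs at hx
  · exact decompose_of_mem_same 𝒜 hx
  · rw [Submodule.mem_bot] at hx
    simp [hx]

variable (𝒜) in
/-- The simple module concentrated in degree `j₀`: its component of degree `j₀` is `A_0 = k`, its
other components vanish, and `A_{≥ 1}` acts by zero (`x` is sent by `a` to the degree-zero part of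
`x a`). -/
def simple (j₀ : ℤ) : GrMod 𝒜 where
  carrier i := simpleComp 𝒜 j₀ i
  act h := LinearMap.mk₂ k
    (fun x a => ⟨GradedAlgebra.proj 𝒜 0 (x.1 * a.1), proj_mul_mem_simpleComp h x.2 a.2⟩)
    (fun _ _ _ => by ext; simp [add_mul]) (fun _ _ _ => by ext; simp)
    (fun _ _ _ => by ext; simp [mul_add]) (fun _ _ _ => by ext; simp)
  act_one _ x := Subtype.ext <| by
    change GradedAlgebra.proj 𝒜 0 (x.1 * 1) = x.1
    rw [mul_one]
    exact proj_eq_of_mem_simpleComp x.2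
  act_mul _ _ _ x a b := Subtype.ext <| by
    change GradedRing.projZeroRingHom 𝒜 (GradedRing.projZeroRingHom 𝒜 (x.1 * a.1) * b.1) =
      GradedRing.projZeroRingHom 𝒜 (x.1 * (a.1 * b.1))
    rw [← mul_assoc, map_mul, map_mul _ (x.1 * a.1)]
    congr 1
    simp

/-- `M` is finitely generated: there is a surjection onto `M` from a finite direct sum of modules
`A(d)`. -/
def IsFG (M : GrMod 𝒜) : Prop :=
  ∃ (s : ℕ) (d : Fin s → ℤ) (f : free 𝒜 d ⟶ M), ∀ i, Function.Surjective (f.app i)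

/-- `M` is coherent: it is finitely generated, and every homomorphism to `M` from a finite direct
sum of modules `A(d)` has a finitely generated kernel. -/
def IsCoherent (M : GrMod 𝒜) : Prop :=
  IsFG M ∧ ∀ (s : ℕ) (d : Fin s → ℤ) (f : free 𝒜 d ⟶ M), IsFG (ker f)

/-- `M` is bounded: `M_i ≠ 0` for only finitely many `i`. -/
def IsBounded (M : GrMod 𝒜) : Prop :=
  {i : ℤ | Nontrivial (M.carrier i)}.Finite

end GrMod

variable (𝒜) in
/-- The graded algebra `A` is (right) coherent: all the modules `A(j)` and all the simple modules
concentrated in one degree are coherent. -/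
def IsCoherentAlgebra : Prop :=
  (∀ j : ℤ, GrMod.IsCoherent ((GrMod.regular 𝒜).twist j)) ∧
    ∀ j : ℤ, GrMod.IsCoherent (GrMod.simple 𝒜 j)

variable (𝒜) in
/-- `coh A`: the full subcategory of `GR A` consisting of the coherent modules. -/
abbrev Coh := ObjectProperty.FullSubcategory (fun M : GrMod 𝒜 => M.IsCoherent)

variable (𝒜) in
/-- `cohᵇ A`: the bounded coherent modules. -/
def IsCohB (M : GrMod 𝒜) : Prop := M.IsCoherent ∧ M.IsBounded

variable (𝒜) in
/-- The morphisms of `coh A` whose kernel and cokernel belong to `cohᵇ A`. (For a coherent algebra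
`A`, kernels and cokernels in the abelian subcategory `coh A` of `GR A` are those of `GR A`.) -/
def isoModBounded : MorphismProperty (Coh 𝒜) := fun _ _ f =>
  IsCohB 𝒜 (GrMod.ker f.hom) ∧ IsCohB 𝒜 (GrMod.coker f.hom)

variable (𝒜) in
/-- `cohproj A = coh A / cohᵇ A`: the quotient category, that is, the localization of `coh A` at
the morphisms whose kernel and cokernel belong to `cohᵇ A`. -/
abbrev CohProj := (isoModBounded 𝒜).Localization

end Modules

section Veronese

variable {k : Type u} [Field k] {A : Type v} [Ring A] [Algebra k A]
  (𝒜 : ℕ → Submodule k A) [GradedAlgebra 𝒜] (n : ℕ)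

theorem veronese_aux_one_mem : (1 : A) ∈ 𝒜 (0 * n) := by
  rw [zero_mul]; exact SetLike.GradedOne.one_mem

theorem veronese_aux_mul_mem {i j : ℕ} {a b : A} (ha : a ∈ 𝒜 (i * n)) (hb : b ∈ 𝒜 (j * n)) :
    a * b ∈ 𝒜 ((i + j) * n) := by
  rw [add_mul]; exact SetLike.GradedMul.mul_mem ha hb

instance : SetLike.GradedMonoid (fun i : ℕ => 𝒜 (i * n)) where
  one_mem := veronese_aux_one_mem 𝒜 n
  mul_mem _ _ _ _ ha hb := veronese_aux_mul_mem 𝒜 n ha hb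

/-- The Veronese subalgebra `A⁽ⁿ⁾ = ⨁_{i ≥ 0} A_{in}` of `A`, consisting of the finite sums of
elements of the subspaces `A_{in}`. -/
def veronese : Subalgebra k A := (DirectSum.coeAlgHom (fun i : ℕ => 𝒜 (i * n))).range

/-- The grading of the Veronese subalgebra: its component of degree `i` is `A_{in}`. -/
def veroneseGrading (i : ℕ) : Submodule k (veronese 𝒜 n) :=
  (𝒜 (i * n)).comap (veronese 𝒜 n).val.toLinearMap

instance : SetLike.GradedMonoid (veroneseGrading 𝒜 n) where
  one_mem := veronese_aux_one_mem 𝒜 n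
  mul_mem _ _ _ _ ha hb := veronese_aux_mul_mem 𝒜 n ha hb

theorem mem_veronese {i : ℕ} {a : A} (ha : a ∈ 𝒜 (i * n)) : a ∈ veronese 𝒜 n :=
  ⟨DirectSum.of (fun i : ℕ => 𝒜 (i * n)) i ⟨a, ha⟩, DirectSum.coeAlgHom_of _ _ _⟩

theorem veroneseGrading_isInternal [NeZero n] :
    DirectSum.IsInternal (veroneseGrading 𝒜 n) := by
  have hind : iSupIndep (fun i : ℕ => 𝒜 (i * n)) :=
    (DirectSum.Decomposition.isInternal 𝒜).submodule_iSupIndep.comp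
      (mul_left_injective₀ (NeZero.ne n))
  refine DirectSum.isInternal_submodule_of_iSupIndep_of_iSup_eq_top ?_ ?_
  · rw [iSupIndep_def]
    intro i
    rw [Submodule.disjoint_def]
    intro x hx hx'
    have h1 : (x : A) ∈ ⨆ (j : ℕ) (_ : j ≠ i), 𝒜 (j * n) := by
      have h2 := Submodule.mem_map_of_mem (f := (veronese 𝒜 n).val.toLinearMap) hx'
      simp only [Submodule.map_iSup] at h2
      exact (iSup₂_mono fun j _ => Submodule.map_comap_le _ _ :
        (⨆ (j : ℕ) (_ : j ≠ i), (veroneseGrading 𝒜 n j).map _) ≤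
          ⨆ (j : ℕ) (_ : j ≠ i), 𝒜 (j * n)) h2
    exact Subtype.ext ((Submodule.disjoint_def.1 (iSupIndep_def.1 hind i)) x hx h1)
  · rw [eq_top_iff]
    rintro ⟨_, d, rfl⟩ -
    induction d using DirectSum.induction_on with
    | zero => exact Submodule.zero_mem _
    | of i a =>
      refine Submodule.mem_iSup_of_mem i ?_
      change (DirectSum.coeAlgHom (fun i : ℕ => 𝒜 (i * n))) (DirectSum.of _ i a) ∈ 𝒜 (i * n)
      rw [DirectSum.coeAlgHom_of]
      exact a.2
    | add d e hd he =>
      have hde := Submodule.add_mem _ hd he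
      convert hde using 1
      exact Subtype.ext (map_add (DirectSum.coeAlgHom (fun i : ℕ => 𝒜 (i * n))) d e)

noncomputable instance [NeZero n] : GradedAlgebra (veroneseGrading 𝒜 n) :=
  DirectSum.IsInternal.gradedAlgebra (veroneseGrading_isInternal 𝒜 n)

end Veronese

end GradedCoherence

/-! Write `M⁽ⁿ⁾` for the Veronese module with components `M_{in}`. Taking it is exact, and it
identifies `A(jn)⁽ⁿ⁾` with `A⁽ⁿ⁾(j)` and the simple module in degree `jn` with the one in degree
`j`.

Two facts about `A` carry the proof. Coherence of `S_0` makes `A_{≥1}` a finitely generated right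
ideal, so every `A_m` is finite-dimensional (`fg_component`). Generation in degree one gives
`A_{p+q} = A_p A_q` (`component_add`). Hence a generator `x` of `M` can be replaced by the
finite-dimensional space `x A_p`, with `p` chosen to reach a degree divisible by `n`, so `M⁽ⁿ⁾` is
finitely generated when `M` is (`IsFG.vero`). Maps from free `A⁽ⁿ⁾`-modules to `M⁽ⁿ⁾` come from maps
of free `A`-modules to `M`, so coherence passes to `M⁽ⁿ⁾` as well (`IsCoherent.vero`); applied to
`A(jn)` and the simple modules, this is the coherence of `A⁽ⁿ⁾`.

For the equivalence, the functor `V : M ↦ M⁽ⁿ⁾` on coherent modules has a left adjoint, obtained by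
lifting presentations, whose unit is an isomorphism (`exists_universal_vero`). So `V` is a
localization. For finitely generated `M`, `M` is bounded exactly when `M⁽ⁿ⁾` is
(`IsBounded.of_vero`), so `V` preserves and reflects the morphisms to be inverted. Composing `V`
with the quotient functor therefore exhibits `cohproj A⁽ⁿ⁾` as a localization of `coh A` at the
morphisms defining `cohproj A`. -/

namespace GradedCoherence

/-! ### Graded homomorphisms, free modules and finite generation. -/

section Generators

variable {k : Type u} [Field k] {A : Type v} [Ring A] [Algebra k A]
  {𝒜 : ℕ → Submodule k A} [GradedAlgebra 𝒜]

namespace GrMod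

@[simp]
theorem id_app (M : GrMod 𝒜) (i : ℤ) (x : M.carrier i) : Hom.app (𝟙 M) i x = x := rfl

@[simp]
theorem comp_app {M N P : GrMod 𝒜} (f : M ⟶ N) (g : N ⟶ P) (i : ℤ) (x : M.carrier i) :
    Hom.app (f ≫ g) i x = g.app i (f.app i x) := rfl

theorem hom_ext {M N : GrMod 𝒜} {f g : M ⟶ N} (h : ∀ i x, f.app i x = g.app i x) : f = g :=
  Hom.ext (funext fun i => LinearMap.ext (h i))

theorem app_act' {M N : GrMod 𝒜} (f : M ⟶ N) {i : ℤ} {j : ℕ} {l : ℤ} (h : i + j = l)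
    (x : M.carrier i) (a : 𝒜 j) : f.app l (M.act h x a) = N.act h (f.app i x) a :=
  f.app_act h x a

/-- A homomorphism of graded modules that is bijective in each degree is an isomorphism. -/
noncomputable def isoOfBijective {M N : GrMod 𝒜} (f : M ⟶ N)
    (hf : ∀ i, Function.Bijective (f.app i)) : M ≅ N where
  hom := f
  inv :=
    { app := fun i => (LinearEquiv.ofBijective (f.app i) (hf i)).symm.toLinearMap
      app_act := fun {i j l} h x a => by
        obtain ⟨y, rfl⟩ := (hf i).2 x
        apply (hf l).1
        rw [app_act']
        have h1 : ∀ i z, f.app i ((LinearEquiv.ofBijective (f.app i) (hf i)).symm z) = z :=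
          fun i z => (LinearEquiv.ofBijective (f.app i) (hf i)).apply_symm_apply z
        erw [h1, h1] }
  hom_inv_id := hom_ext fun i x => (LinearEquiv.ofBijective (f.app i) (hf i)).symm_apply_apply x
  inv_hom_id := hom_ext fun i x => (LinearEquiv.ofBijective (f.app i) (hf i)).apply_symm_apply x

theorem bijective_app_of_isIso {M N : GrMod 𝒜} (f : M ⟶ N) [IsIso f] (i : ℤ) :
    Function.Bijective (f.app i) := by
  refine Function.bijective_iff_has_inverse.2 ⟨(inv f).app i, fun x => ?_, fun x => ?_⟩
  · rw [← comp_app, IsIso.hom_inv_id]; rfl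
  · rw [← comp_app, IsIso.inv_hom_id]; rfl

/-- A homomorphism that kills the kernel of a surjection `p : P ⟶ N` factors through `p`. -/
theorem exists_factor {P N Q : GrMod 𝒜} (p : P ⟶ N) (hp : ∀ i, Function.Surjective (p.app i))
    (f : P ⟶ Q) (h : ∀ i x, p.app i x = 0 → f.app i x = 0) : ∃ g : N ⟶ Q, p ≫ g = f := by
  have hker : ∀ i, LinearMap.ker (p.app i) ≤ LinearMap.ker (f.app i) := fun i x => h i x
  have key : ∀ i x, (((LinearMap.ker (p.app i)).liftQ (f.app i) (hker i)).comp
      ((p.app i).quotKerEquivOfSurjective (hp i)).symm.toLinearMap) (p.app i x) = f.app i x := by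
    intro i x
    have : ((p.app i).quotKerEquivOfSurjective (hp i)).symm (p.app i x)
        = Submodule.Quotient.mk x := by
      rw [LinearEquiv.symm_apply_eq]; rfl
    simp [this]
  refine ⟨{ app := fun i => ((LinearMap.ker (p.app i)).liftQ (f.app i) (hker i)).comp
              ((p.app i).quotKerEquivOfSurjective (hp i)).symm.toLinearMap
            app_act := fun {i j l} hl x a => ?_ }, hom_ext fun i x => key i x⟩
  obtain ⟨y, rfl⟩ := hp i x
  rw [← app_act', key, key, app_act']

theorem cancel_surjective {P N Q : GrMod 𝒜} (p : P ⟶ N)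
    (hp : ∀ i, Function.Surjective (p.app i)) {f g : N ⟶ Q} (h : p ≫ f = p ≫ g) : f = g := by
  refine hom_ext fun i x => ?_
  obtain ⟨y, rfl⟩ := hp i x
  rw [← comp_app, h, comp_app]

/-- The inclusion of the kernel. -/
def kerι {M N : GrMod 𝒜} (f : M ⟶ N) : ker f ⟶ M where
  app i := (LinearMap.ker (f.app i)).subtype
  app_act _ _ _ := rfl

theorem kerι_injective {M N : GrMod 𝒜} (f : M ⟶ N) (i : ℤ) :
    Function.Injective ((kerι f).app i) := Subtype.val_injective

theorem kerι_app_mem {M N : GrMod 𝒜} (f : M ⟶ N) (i : ℤ) (x : (ker f).carrier i) :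
    f.app i ((kerι f).app i x) = 0 := x.2

/-- Homomorphisms to a kernel. -/
def kerLift {M N P : GrMod 𝒜} (f : M ⟶ N) (g : P ⟶ M) (h : ∀ i x, f.app i (g.app i x) = 0) :
    P ⟶ ker f where
  app i := (g.app i).codRestrict _ (h i)
  app_act hl x a := Subtype.ext (g.app_act hl x a)

/-- The projection to the cokernel. -/
def cokerπ {M N : GrMod 𝒜} (f : M ⟶ N) : N ⟶ coker f where
  app i := (LinearMap.range (f.app i)).mkQ
  app_act _ _ _ := rfl

theorem cokerπ_surjective {M N : GrMod 𝒜} (f : M ⟶ N) (i : ℤ) :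
    Function.Surjective ((cokerπ f).app i) := Submodule.Quotient.mk_surjective _

theorem cokerπ_app_eq_zero {M N : GrMod 𝒜} (f : M ⟶ N) (i : ℤ) (x : N.carrier i) :
    (cokerπ f).app i x = 0 ↔ ∃ y, f.app i y = x :=
  Submodule.Quotient.mk_eq_zero _

/-- The action of `A_d`, `d ∈ ℤ`, on a graded module. -/
def smulComp (M : GrMod 𝒜) {i d l : ℤ} (h : i + d = l) :
    M.carrier i →ₗ[k] comp 𝒜 d →ₗ[k] M.carrier l :=
  match d, h with
  | Int.ofNat _, h => M.act h
  | Int.negSucc _, _ => 0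

theorem app_smulComp {M N : GrMod 𝒜} (f : M ⟶ N) {i d l : ℤ} (h : i + d = l) (x : M.carrier i)
    (a : comp 𝒜 d) : f.app l (M.smulComp h x a) = N.smulComp h (f.app i x) a := by
  cases d with
  | ofNat d => exact app_act' f h x a
  | negSucc d => exact map_zero _

theorem act_smulComp (M : GrMod 𝒜) {i d l m : ℤ} {j : ℕ} (h : i + d = l) (h' : l + j = m)
    (h'' : i + (d + j) = m) (x : M.carrier i) (a : comp 𝒜 d) (b : 𝒜 j) :
    M.act h' (M.smulComp h x a) b =
      M.smulComp h'' x ⟨a.1 * b.1, mul_mem_comp rfl a.2 b.2⟩ := by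
  cases d with
  | ofNat d => exact M.act_mul h h' h'' x a b
  | negSucc d =>
    have ha : a.1 = 0 := a.2
    have : (⟨a.1 * b.1, mul_mem_comp rfl a.2 b.2⟩ : comp 𝒜 (Int.negSucc d + j)) = 0 :=
      Subtype.ext (by simp [ha])
    rw [this, map_zero]
    simp [smulComp]

theorem one_mem_comp {d : ℤ} (hd : d = 0) : (1 : A) ∈ comp 𝒜 d := by
  subst hd; exact SetLike.GradedOne.one_mem (A := 𝒜)

theorem smulComp_one (M : GrMod 𝒜) {i d : ℤ} (h : i + d = i) (hd : d = 0) (x : M.carrier i) :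
    M.smulComp h x ⟨1, one_mem_comp hd⟩ = x := by
  subst hd; exact M.act_one h x

theorem smulComp_congr (M : GrMod 𝒜) {i d d' l : ℤ} (h : i + d = l) (h' : i + d' = l)
    (x : M.carrier i) {a : comp 𝒜 d} {a' : comp 𝒜 d'} (ha : a.1 = a'.1) :
    M.smulComp h x a = M.smulComp h' x a' := by
  obtain rfl : d = d' := by omega
  rw [Subtype.ext ha]

/-- The direct sum of a finite family of graded modules. -/
def pi {ι : Type} (M : ι → GrMod 𝒜) : GrMod 𝒜 where
  carrier i := ∀ t : ι, (M t).carrier i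
  act h := LinearMap.mk₂ k (fun x a t => (M t).act h (x t) a)
    (fun _ _ _ => by ext; simp) (fun _ _ _ => by ext; simp)
    (fun _ _ _ => by ext; simp) (fun _ _ _ => by ext; simp)
  act_one h x := by ext t; exact (M t).act_one h (x t)
  act_mul h h' h'' x a b := by ext t; exact (M t).act_mul h h' h'' (x t) a b

/-- The direct sum of the twists `A(d_t)`, for `t` in a finite set. -/
def freeOn (𝒜 : ℕ → Submodule k A) [GradedAlgebra 𝒜] {ι : Type} (d : ι → ℤ) : GrMod 𝒜 :=
  pi fun t => (regular 𝒜).twist (d t)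

theorem neg_add_self_apply {ι : Type} (d : ι → ℤ) : ∀ t, -d t + d t = 0 :=
  fun t => neg_add_cancel (d t)

section Free

variable {ι : Type} {d e : ι → ℤ}

/-- The coordinates on a free module. -/
def coord (t : ι) (i : ℤ) : (freeOn 𝒜 d).carrier i →ₗ[k] comp 𝒜 (i + d t) :=
  LinearMap.proj (φ := fun t => comp 𝒜 (i + d t)) t

/-- The element of a free module with given coordinates. -/
def ofCoord {i : ℤ} (x : ∀ t, comp 𝒜 (i + d t)) : (freeOn 𝒜 d).carrier i := x

@[simp]
theorem coord_ofCoord {i : ℤ} (x : ∀ t, comp 𝒜 (i + d t)) (t : ι) :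
    coord t i (ofCoord x) = x t := rfl

theorem freeOn_ext {i : ℤ} {x y : (freeOn 𝒜 d).carrier i}
    (h : ∀ t, (coord t i x : A) = coord t i y) : x = y :=
  funext fun t => Subtype.ext (h t)

theorem coord_smulComp {i c l : ℤ} (h : i + c = l) (x : (freeOn 𝒜 d).carrier i) (a : comp 𝒜 c)
    (t : ι) : (coord t l ((freeOn 𝒜 d).smulComp h x a) : A) = coord t i x * a := by
  cases c with
  | ofNat c => rfl
  | negSucc c =>
    have ha : a.1 = 0 := a.2
    rw [ha, mul_zero]
    rfl

/-- The standard generators of a free module. -/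
noncomputable def gen (h : ∀ t, e t + d t = 0) (t : ι) : (freeOn 𝒜 d).carrier (e t) :=
  open Classical in ofCoord fun t' =>
    if ht : t' = t then ⟨1, one_mem_comp (by subst ht; exact h t')⟩ else 0

theorem coord_gen_same (h : ∀ t, e t + d t = 0) (t : ι) :
    coord t (e t) (gen (𝒜 := 𝒜) h t) = ⟨1, one_mem_comp (h t)⟩ := by
  simp [gen]

theorem coord_gen_ne (h : ∀ t, e t + d t = 0) {t t' : ι} (ht : t' ≠ t) :
    coord t' (e t) (gen (𝒜 := 𝒜) h t) = 0 := by
  simp [gen, ht]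

variable [Fintype ι]

theorem sum_smulComp_gen (h : ∀ t, e t + d t = 0) {i : ℤ} (x : (freeOn 𝒜 d).carrier i) :
    ∑ t, (freeOn 𝒜 d).smulComp (by have := h t; omega : e t + (i + d t) = i) (gen h t)
      (coord t i x) = x := by
  refine freeOn_ext fun t => ?_
  rw [map_sum, Submodule.coe_sum, Finset.sum_eq_single t]
  · rw [coord_smulComp, coord_gen_same, one_mul]
  · intro t' _ ht
    rw [coord_smulComp, coord_gen_ne h ht.symm, Submodule.coe_zero, zero_mul]
  · simp

theorem freeOn_hom_ext (h : ∀ t, e t + d t = 0) {M : GrMod 𝒜} {f g : freeOn 𝒜 d ⟶ M}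
    (hfg : ∀ t, f.app (e t) (gen h t) = g.app (e t) (gen h t)) : f = g := by
  refine hom_ext fun i x => ?_
  rw [← sum_smulComp_gen h x, map_sum, map_sum]
  exact Finset.sum_congr rfl fun t _ => by rw [app_smulComp, app_smulComp, hfg]

/-- The homomorphism from a free module given by the images of the generators. -/
def freeLift (h : ∀ t, e t + d t = 0) {M : GrMod 𝒜} (x : ∀ t, M.carrier (e t)) :
    freeOn 𝒜 d ⟶ M where
  app i := ∑ t, (M.smulComp (by have := h t; omega : e t + (i + d t) = i) (x t)).comp
    (coord t i)
  app_act {i j l} hl y a := by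
    rw [LinearMap.sum_apply, LinearMap.sum_apply, map_sum, LinearMap.sum_apply]
    refine Finset.sum_congr rfl fun t _ => ?_
    rw [LinearMap.comp_apply, LinearMap.comp_apply,
      act_smulComp _ _ _ (by have := h t; omega)]
    exact smulComp_congr _ _ _ _ rfl

theorem freeLift_apply (h : ∀ t, e t + d t = 0) {M : GrMod 𝒜} (x : ∀ t, M.carrier (e t))
    (i : ℤ) (y : (freeOn 𝒜 d).carrier i) : (freeLift h x).app i y =
      ∑ t, M.smulComp (by have := h t; omega : e t + (i + d t) = i) (x t) (coord t i y) := by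
  simp only [freeLift, LinearMap.sum_apply, LinearMap.comp_apply]

theorem freeLift_gen (h : ∀ t, e t + d t = 0) {M : GrMod 𝒜} (x : ∀ t, M.carrier (e t)) (t : ι) :
    (freeLift h x).app (e t) (gen h t) = x t := by
  rw [freeLift_apply, Finset.sum_eq_single t]
  · rw [coord_gen_same, smulComp_one _ _ (h t)]
  · intro t' _ ht
    rw [coord_gen_ne h ht, map_zero]
  · simp

/-- Free modules are projective. -/
theorem freeOn_exists_lift {M N : GrMod 𝒜} (p : M ⟶ N)
    (hp : ∀ i, Function.Surjective (p.app i)) (f : freeOn 𝒜 d ⟶ N) :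
    ∃ g : freeOn 𝒜 d ⟶ M, g ≫ p = f := by
  choose x hx using fun t => hp (-d t) (f.app _ (gen (neg_add_self_apply d) t))
  refine ⟨freeLift (neg_add_self_apply d) x, freeOn_hom_ext (neg_add_self_apply d) fun t => ?_⟩
  rw [comp_app, freeLift_gen, hx]

variable (d) in
theorem exists_iso_free : ∃ (s : ℕ) (d' : Fin s → ℤ), Nonempty (free 𝒜 d' ≅ freeOn 𝒜 d) := by
  let E := Fintype.equivFin ι
  let f : freeOn 𝒜 d ⟶ free 𝒜 (d ∘ E.symm) :=
    { app := fun i =>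
        { toFun := fun y t => y (E.symm t)
          map_add' := fun _ _ => rfl
          map_smul' := fun _ _ => rfl }
      app_act := fun _ _ _ => rfl }
  exact ⟨_, _, ⟨(isoOfBijective f fun i => (Equiv.piCongrLeft' _ E).bijective).symm⟩⟩

theorem isFG_of_surjective_freeOn {M : GrMod 𝒜} (f : freeOn 𝒜 d ⟶ M)
    (hf : ∀ i, Function.Surjective (f.app i)) : IsFG M := by
  obtain ⟨s, d', ⟨φ⟩⟩ := exists_iso_free (𝒜 := 𝒜) d
  exact ⟨s, d', φ.hom ≫ f, fun i => (hf i).comp (bijective_app_of_isIso φ.hom i).2⟩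

end Free

theorem IsFG.of_surjective {M N : GrMod 𝒜} (hM : IsFG M) (f : M ⟶ N)
    (hf : ∀ i, Function.Surjective (f.app i)) : IsFG N := by
  obtain ⟨s, d, g, hg⟩ := hM
  exact ⟨s, d, g ≫ f, fun i => (hf i).comp (hg i)⟩

/-- A graded module generated by finitely many finite-dimensional spaces of homogeneous elements
is finitely generated. -/
theorem isFG_of_span {M : GrMod 𝒜} {ι : Type} [Fintype ι] (e : ι → ℤ)
    (X : ∀ t, Submodule k (M.carrier (e t))) (hX : ∀ t, (X t).FG)
    (h : ∀ (i : ℤ) (T : Submodule k (M.carrier i)), (∀ (t : ι) (j : ℕ) (hj : e t + j = i),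
      ∀ x ∈ X t, ∀ a : 𝒜 j, M.act hj x a ∈ T) → T = ⊤) : IsFG M := by
  choose r x hx using fun t => Submodule.fg_iff_exists_fin_generating_family.1 (hX t)
  let d : (Σ t, Fin (r t)) → ℤ := fun p => -e p.1
  have hd : ∀ p : (Σ t, Fin (r t)), e p.1 + d p = 0 := fun p => add_neg_cancel _
  let f : freeOn 𝒜 d ⟶ M := freeLift hd fun p => x p.1 p.2
  refine isFG_of_surjective_freeOn f fun i => ?_
  rw [← LinearMap.range_eq_top]
  refine h i _ fun t j hj y hy a => ?_
  have h1 : X t ≤ LinearMap.range (f.app (e t)) := by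
    rw [← hx, Submodule.span_le]
    rintro _ ⟨p, rfl⟩
    exact ⟨gen hd ⟨t, p⟩, freeLift_gen hd _ (⟨t, p⟩ : Σ t, Fin (r t))⟩
  obtain ⟨z, rfl⟩ := h1 hy
  exact ⟨(freeOn 𝒜 d).act hj z a, app_act' f hj z a⟩

/-- A finitely generated module is spanned by the multiples of finitely many homogeneous
elements. -/
theorem IsFG.exists_span {M : GrMod 𝒜} (hM : IsFG M) :
    ∃ (s : ℕ) (e : Fin s → ℤ) (x : ∀ t, M.carrier (e t)), ∀ i,
      Submodule.span k {y : M.carrier i | ∃ (t : Fin s) (j : ℕ) (hj : e t + j = i) (a : 𝒜 j),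
        M.act hj (x t) a = y} = ⊤ := by
  obtain ⟨s, d, f, hf⟩ : ∃ (s : ℕ) (d : Fin s → ℤ) (f : freeOn 𝒜 d ⟶ M),
    ∀ i, Function.Surjective (f.app i) := hM
  have hd := neg_add_self_apply d
  refine ⟨s, fun t => -d t, fun t => f.app _ (gen hd t), fun i => ?_⟩
  rw [eq_top_iff]
  intro y _
  obtain ⟨z, rfl⟩ := hf i y
  -- A coordinate may lie in a negative degree `c`, where `smulComp` is zero by definition, so only
  -- multiples by genuine elements of `A_j` remain.
  have hc : ∀ (t : Fin s) (c : ℤ) (hc : -d t + c = i) (a : comp 𝒜 c),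
      M.smulComp hc (f.app (-d t) (gen hd t)) a ∈ Submodule.span k {y : M.carrier i |
        ∃ (t : Fin s) (j : ℕ) (hj : -d t + j = i) (a : 𝒜 j),
          M.act hj (f.app (-d t) (gen hd t)) a = y} := by
    intro t c hc a
    cases c with
    | ofNat c => exact Submodule.subset_span ⟨t, c, hc, a, rfl⟩
    | negSucc c => exact Submodule.zero_mem _
  rw [← sum_smulComp_gen hd z, map_sum]
  refine Submodule.sum_mem _ fun t _ => ?_
  rw [app_smulComp]
  exact hc t _ _ _

end GrMod

end Generators

/-! ### Closure properties of coherent modules. -/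

section Coherence

variable {k : Type u} [Field k] {A : Type v} [Ring A] [Algebra k A]
  {𝒜 : ℕ → Submodule k A} [GradedAlgebra 𝒜]

namespace GrMod

theorem isFG_freeOn {ι : Type} [Fintype ι] (d : ι → ℤ) : IsFG (freeOn 𝒜 d) :=
  isFG_of_surjective_freeOn (𝟙 _) fun _ => Function.surjective_id

/-- `K` surjects onto `ker f`. Since `g` need not be injective, any finitely generated module whose
image is the kernel will do. -/
theorem isFG_ker_of_exact {K P M : GrMod 𝒜} (hK : IsFG K) (g : K ⟶ P) (f : P ⟶ M)
    (h : ∀ i, Function.Exact (g.app i) (f.app i)) : IsFG (ker f) :=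
  hK.of_surjective (kerLift f g fun i x => (h i).apply_apply_eq_zero x) fun i x => by
    obtain ⟨y, hy⟩ := (h i x.1).1 x.2
    exact ⟨y, Subtype.ext hy⟩

theorem exact_kerι {M N : GrMod 𝒜} (f : M ⟶ N) (i : ℤ) :
    Function.Exact ((kerι f).app i) (f.app i) := fun x =>
  ⟨fun hx => ⟨⟨x, hx⟩, rfl⟩, by rintro ⟨y, rfl⟩; exact y.2⟩

theorem isFG_ker_of_surjective_comp {P Q M : GrMod 𝒜} (p : P ⟶ Q)
    (hp : ∀ i, Function.Surjective (p.app i)) (f : Q ⟶ M) (h : IsFG (ker (p ≫ f))) :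
    IsFG (ker f) :=
  isFG_ker_of_exact h (kerι (p ≫ f) ≫ p) f fun i x => by
    constructor
    · intro hx
      obtain ⟨y, rfl⟩ := hp i x
      exact ⟨⟨y, hx⟩, rfl⟩
    · rintro ⟨y, rfl⟩
      exact y.2

/-- Precomposing with a free cover of `M` reduces to the free sources in the definition of
coherence. -/
theorem IsFG.ker {M N : GrMod 𝒜} (hM : IsFG M) (hN : IsCoherent N) (f : M ⟶ N) :
    IsFG (ker f) := by
  obtain ⟨s, d, p, hp⟩ := hM
  exact isFG_ker_of_surjective_comp p hp f (hN.2 s d _)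

theorem IsCoherent.of_injective {M N : GrMod 𝒜} (hM : IsCoherent M) (hN : IsFG N) (f : N ⟶ M)
    (hf : ∀ i, Function.Injective (f.app i)) : IsCoherent N := by
  refine ⟨hN, fun s d g => ?_⟩
  refine isFG_ker_of_exact (hM.2 s d (g ≫ f)) (kerι _) g fun i x => ?_
  rw [← exact_kerι (g ≫ f) i x, comp_app, map_eq_zero_iff _ (hf i)]

theorem IsCoherent.of_iso {M N : GrMod 𝒜} (hM : IsCoherent M) (φ : M ≅ N) : IsCoherent N :=
  hM.of_injective (hM.1.of_surjective φ.hom fun i => (bijective_app_of_isIso _ i).2) φ.inv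
    fun i => (bijective_app_of_isIso _ i).1

theorem IsCoherent.ker {M N : GrMod 𝒜} (hM : IsCoherent M) (hN : IsCoherent N) (f : M ⟶ N) :
    IsCoherent (ker f) :=
  hM.of_injective (hM.1.ker hN f) (kerι f) (kerι_injective f)

/-- The homomorphism from a direct sum of two free modules given by homomorphisms from the
summands. -/
def sumDesc {ι κ : Type} {d : ι → ℤ} {e : κ → ℤ} {M : GrMod 𝒜} (f : freeOn 𝒜 d ⟶ M)
    (g : freeOn 𝒜 e ⟶ M) : freeOn 𝒜 (Sum.elim d e) ⟶ M where
  app i :=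
    { toFun := fun x => f.app i (ofCoord fun t => coord (Sum.inl t) i x) +
        g.app i (ofCoord fun t => coord (Sum.inr t) i x)
      map_add' := fun x y => by
        rw [add_add_add_comm, ← map_add, ← map_add]
        rfl
      map_smul' := fun c x => by
        rw [RingHom.id_apply, smul_add, ← map_smul, ← map_smul]
        rfl }
  app_act h x a := by
    have := app_act' f h (ofCoord fun t => coord (Sum.inl t) _ x) a
    have := app_act' g h (ofCoord fun t => coord (Sum.inr t) _ x) a
    simp only [LinearMap.coe_mk, AddHom.coe_mk, map_add, LinearMap.add_apply, ← app_act']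
    rfl

/-- The projection from a direct sum of two free modules to the first summand. -/
def sumFst {ι κ : Type} (d : ι → ℤ) (e : κ → ℤ) : freeOn 𝒜 (Sum.elim d e) ⟶ freeOn 𝒜 d where
  app i :=
    { toFun := fun x => ofCoord fun t => coord (Sum.inl t) i x
      map_add' := fun _ _ => rfl
      map_smul' := fun _ _ => rfl }
  app_act _ _ _ := rfl

theorem IsCoherent.isFG_ker_freeOn {M : GrMod 𝒜} (hM : IsCoherent M) {ι : Type} [Fintype ι]
    {d : ι → ℤ} (f : freeOn 𝒜 d ⟶ M) : IsFG (GrMod.ker f) :=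
  (isFG_freeOn d).ker hM f

/-- The quotient of a coherent module by a finitely generated submodule is coherent. -/
theorem IsCoherent.of_surjective {N C : GrMod 𝒜} (hN : IsCoherent N) (p : N ⟶ C)
    (hp : ∀ i, Function.Surjective (p.app i)) (hK : IsFG (GrMod.ker p)) : IsCoherent C := by
  refine ⟨hN.1.of_surjective p hp, fun s d φ => ?_⟩
  obtain ⟨r, e, q, hq⟩ : ∃ (r : ℕ) (e : Fin r → ℤ) (q : freeOn 𝒜 e ⟶ GrMod.ker p),
    ∀ i, Function.Surjective (q.app i) := hK
  obtain ⟨φ', rfl⟩ : ∃ g : freeOn 𝒜 d ⟶ N, g ≫ p = φ := freeOn_exists_lift p hp φ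
  -- With `φ'` lifting the given map and `q` covering `ker p`, a vector `x` goes to zero in `C`
  -- exactly when `φ' x` is cancelled by a value of `q`. So the kernel of the joint map to `N`
  -- projects onto the required kernel.
  refine isFG_ker_of_exact (hN.isFG_ker_freeOn (sumDesc φ' (q ≫ kerι p)))
    (kerι _ ≫ sumFst d e) (φ' ≫ p) fun i x => ?_
  constructor
  · intro hx
    obtain ⟨z, hz⟩ := hq i ⟨φ'.app i x, hx⟩
    refine ⟨⟨ofCoord (Sum.rec (fun t => coord t i x) fun t => coord t i (-z)), ?_⟩, rfl⟩
    change φ'.app i x + (kerι p).app i (q.app i (-z)) = 0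
    have hz' : (kerι p).app i (q.app i z) = φ'.app i x := congrArg Subtype.val hz
    rw [map_neg, map_neg, hz', add_neg_cancel]
  · rintro ⟨⟨y, hy⟩, rfl⟩
    change φ'.app i ((sumFst d e).app i y) +
      (q.app i (ofCoord fun t => coord (Sum.inr t) i y)).1 = 0 at hy
    change p.app i (φ'.app i ((sumFst d e).app i y)) = 0
    rw [eq_neg_of_add_eq_zero_left hy, map_neg, neg_eq_zero]
    exact (q.app i (ofCoord fun t => coord (Sum.inr t) i y)).2

theorem IsCoherent.coker {M N : GrMod 𝒜} (hM : IsFG M) (hN : IsCoherent N) (f : M ⟶ N) :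
    IsCoherent (coker f) :=
  hN.of_surjective (cokerπ f) (cokerπ_surjective f) <|
    isFG_ker_of_exact hM f _ fun i x => cokerπ_app_eq_zero f i x

/-- The kernels are cut out one at a time, each stage staying finitely generated. This serves to
test a map into a finite direct sum coordinate by coordinate. -/
theorem exists_joint_kernel {P : GrMod 𝒜} (hP : IsFG P) : ∀ (s : ℕ) (M : Fin s → GrMod 𝒜)
    (_ : ∀ t, IsCoherent (M t)) (f : ∀ t, P ⟶ M t), ∃ (K : GrMod 𝒜) (_ : IsFG K) (j : K ⟶ P),
      ∀ i x, (∃ y, j.app i y = x) ↔ ∀ t, (f t).app i x = 0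
  | 0, _, _, _ => ⟨P, hP, 𝟙 P, fun i x => by simp⟩
  | s + 1, M, hM, f => by
    obtain ⟨K, hK, j, hj⟩ := exists_joint_kernel hP s (fun t => M t.succ)
      (fun t => hM t.succ) (fun t => f t.succ)
    refine ⟨GrMod.ker (j ≫ f 0), hK.ker (hM 0) _, kerι _ ≫ j, fun i x => ?_⟩
    rw [Fin.forall_fin_succ, ← hj]
    constructor
    · rintro ⟨y, rfl⟩
      exact ⟨y.2, _, rfl⟩
    · rintro ⟨h0, y, rfl⟩
      exact ⟨⟨y, h0⟩, rfl⟩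

/-- The projections of a free module to its summands. -/
def freeProj {ι : Type} (d : ι → ℤ) (t : ι) : freeOn 𝒜 d ⟶ (regular 𝒜).twist (d t) where
  app i := coord t i
  app_act _ _ _ := rfl

theorem isCoherent_free (h : ∀ j, IsCoherent ((regular 𝒜).twist j)) {s : ℕ} (d : Fin s → ℤ) :
    IsCoherent (freeOn 𝒜 d) := by
  refine ⟨isFG_freeOn d, fun r e f => ?_⟩
  obtain ⟨K, hK, j, hj⟩ := exists_joint_kernel (isFG_freeOn e) s _ (fun t => h (d t))
    (fun t => f ≫ freeProj d t)
  refine isFG_ker_of_exact hK j f fun i x => ?_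
  rw [Set.mem_range, hj]
  exact ⟨fun hx t => (congrArg (coord t i) hx).trans (map_zero _), fun hx => funext hx⟩

end GrMod

end Coherence

/-! ### Finite-dimensional components and generation in degree one. -/

section Algebra

variable {k : Type u} [Field k] {A : Type v} [Ring A] [Algebra k A]
  {𝒜 : ℕ → Submodule k A} [GradedAlgebra 𝒜]

namespace GrMod

theorem simple_smulComp {j₀ i c l : ℤ} (h : i + c = l) (x : (simple 𝒜 j₀).carrier i)
    (a : comp 𝒜 c) :
    ((simple 𝒜 j₀).smulComp h x a).1 = GradedAlgebra.proj 𝒜 0 (x.1 * a.1) := by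
  cases c with
  | ofNat c => rfl
  | negSucc c =>
    have ha : a.1 = 0 := a.2
    rw [ha, mul_zero, map_zero]
    rfl

/-- The unit element of the simple module concentrated in degree `0`. -/
def simpleOne (𝒜 : ℕ → Submodule k A) [GradedAlgebra 𝒜] : (simple 𝒜 0).carrier 0 :=
  ⟨1, by
    rw [simpleComp, if_pos rfl]
    exact SetLike.GradedOne.one_mem⟩

end GrMod

open GrMod

/-- The kernel of `A → S_0` is `A_{≥1}`, generated by finitely many homogeneous `w_t`. For `m > 0`
this gives `A_m = ∑ w_t A_{m - e_t}`, a sum over lower degrees, and induction applies. Connectedness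
starts it at `m = 0`. -/
theorem fg_component (hconn : IsConnected 𝒜) (hS : IsCoherent (simple 𝒜 0)) (m : ℕ) :
    (𝒜 m).FG := by
  let d : Unit → ℤ := fun _ => 0
  have hd : ∀ t : Unit, (fun _ : Unit => (0 : ℤ)) t + d t = 0 := fun _ => rfl
  let f : freeOn 𝒜 d ⟶ simple 𝒜 0 := freeLift hd fun _ => simpleOne 𝒜
  obtain ⟨s, e, z, hz⟩ := (hS.isFG_ker_freeOn f).exists_span
  let w : Fin s → A := fun t => coord () (e t) ((kerι f).app (e t) (z t))
  -- Negative components of `A` vanish, and `f` is injective on `A_0`. So the nonzero generators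
  -- have positive degree, which makes the induction descend.
  have hw : ∀ t, e t ≤ 0 → w t = 0 := by
    intro t ht
    have hmem : w t ∈ comp 𝒜 (e t + 0) := Subtype.prop _
    rw [add_zero] at hmem
    rcases ht.lt_or_eq with hlt | heq
    · obtain ⟨c, hc⟩ := Int.eq_negSucc_of_lt_zero hlt
      rw [hc] at hmem
      exact hmem
    · have h0 := congrArg Subtype.val (kerι_app_mem f _ (z t))
      rw [freeLift_apply, Fintype.sum_unique, simple_smulComp] at h0
      change GradedAlgebra.proj 𝒜 0 (1 * w t) = 0 at h0
      rw [heq] at hmem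
      rw [one_mul, GradedAlgebra.proj_apply, decompose_of_mem_same 𝒜 hmem] at h0
      exact h0
  induction m using Nat.strong_induction_on with
  | _ m ih =>
  rcases Nat.eq_zero_or_pos m with rfl | hm
  · refine ⟨{1}, le_antisymm ?_ ?_⟩
    · rw [Submodule.span_le]
      simpa using SetLike.GradedOne.one_mem (A := 𝒜)
    · intro a ha
      obtain ⟨c, rfl⟩ := hconn.eq_scalar a ha
      rw [Algebra.algebraMap_eq_smul_one]
      exact Submodule.smul_mem _ _ (Submodule.subset_span (by simp))
  · let S : Submodule k A := ⨆ p : Fin s × Fin m, (𝒜 p.2).map (LinearMap.mulLeft k (w p.1))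
    have hS : S.FG := Submodule.fg_iSup _ fun p => (ih p.2 p.2.2).map _
    have hle : 𝒜 m ≤ S := by
      intro x hx
      have hx' : x ∈ comp 𝒜 ((m : ℤ) + 0) := by rw [add_zero]; exact hx
      let X : (freeOn 𝒜 d).carrier (m : ℤ) := ofCoord fun _ => ⟨x, hx'⟩
      have hX : f.app m X = 0 := by
        have h1 : (f.app m X).1 ∈ simpleComp 𝒜 0 m := (f.app m X).2
        have h2 : simpleComp 𝒜 0 (m : ℤ) = ⊥ := if_neg (by omega)
        exact Subtype.ext (h2.le h1)
      let φ : (ker f).carrier (m : ℤ) →ₗ[k] A :=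
        (comp 𝒜 ((m : ℤ) + 0)).subtype ∘ₗ coord (d := d) () m ∘ₗ (kerι f).app m
      have h2 : (⊤ : Submodule k ((ker f).carrier (m : ℤ))) ≤ S.comap φ := by
        rw [← hz, Submodule.span_le]
        rintro _ ⟨t, j, hj, a, rfl⟩
        change w t * a ∈ S
        by_cases ht : e t ≤ 0
        · rw [hw t ht, zero_mul]
          exact S.zero_mem
        · exact Submodule.mem_iSup_of_mem (t, ⟨j, by omega⟩) ⟨a, a.2, rfl⟩
      exact h2 (x := ⟨X, hX⟩) trivial
    have : FiniteDimensional k S := Module.Finite.iff_fg.2 hS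
    exact Module.Finite.iff_fg.1 (Submodule.finiteDimensional_of_le hle)

/-- The powers `A_1 ^ i` span `A` and lie in `A_i`; projecting to degree `m` leaves only the `m`-th
power. -/
theorem component_eq_pow (hgen : IsGeneratedInDegreeOne 𝒜) (m : ℕ) : 𝒜 m = 𝒜 1 ^ m := by
  have hle : ∀ m, 𝒜 1 ^ m ≤ 𝒜 m := by
    intro m
    induction m with
    | zero => rw [pow_zero, Submodule.one_le]; exact SetLike.GradedOne.one_mem
    | succ m ih =>
      rw [pow_succ, Submodule.mul_le]
      exact fun a ha b hb => SetLike.GradedMul.mul_mem (ih ha) hb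
  refine le_antisymm (fun x hx => ?_) (hle m)
  have htop : (⊤ : Submodule k A) ≤ ⨆ i, 𝒜 1 ^ i := by
    have h1 : Subalgebra.toSubmodule (Algebra.adjoin k (𝒜 1 : Set A)) = ⊤ := by
      rw [show Algebra.adjoin k (𝒜 1 : Set A) = ⊤ from hgen]; rfl
    rw [← h1, Algebra.adjoin_eq_span, Submodule.span_le]
    intro y hy
    have : ∃ i, y ∈ 𝒜 1 ^ i := by
      induction hy using Submonoid.closure_induction with
      | mem y hy => exact ⟨1, by rw [pow_one]; exact hy⟩
      | one => exact ⟨0, by rw [pow_zero]; exact Submodule.one_le.1 le_rfl⟩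
      | mul y z _ _ hy hz =>
        obtain ⟨i, hi⟩ := hy
        obtain ⟨j, hj⟩ := hz
        exact ⟨i + j, by rw [pow_add]; exact Submodule.mul_mem_mul hi hj⟩
    obtain ⟨i, hi⟩ := this
    exact Submodule.mem_iSup_of_mem i hi
  have key : ∀ y : A, GradedAlgebra.proj 𝒜 m y ∈ 𝒜 1 ^ m := by
    intro y
    refine Submodule.iSup_induction _ (motive := fun y => GradedAlgebra.proj 𝒜 m y ∈ 𝒜 1 ^ m)
      (htop (Submodule.mem_top (x := y))) (fun i y hy => ?_) ?_ fun y z hy hz => ?_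
    · rw [GradedAlgebra.proj_apply]
      by_cases h : i = m
      · subst h
        rwa [decompose_of_mem_same 𝒜 (hle i hy)]
      · rw [decompose_of_mem_ne 𝒜 (hle i hy) h]
        exact Submodule.zero_mem _
    · rw [map_zero]; exact Submodule.zero_mem _
    · rw [map_add]; exact Submodule.add_mem _ hy hz
  have := key x
  rwa [GradedAlgebra.proj_apply, decompose_of_mem_same 𝒜 hx] at this

theorem component_add (hgen : IsGeneratedInDegreeOne 𝒜) (p q : ℕ) :
    𝒜 (p + q) = 𝒜 p * 𝒜 q := by
  rw [component_eq_pow hgen (p + q), component_eq_pow hgen p, component_eq_pow hgen q, pow_add]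

namespace GrMod

/-- If `A` is generated in degree one, then `x A_{p+q}` is contained in the span of
`(x A_p) A_q`. -/
theorem act_add_mem_span (hgen : IsGeneratedInDegreeOne 𝒜) (M : GrMod 𝒜) {i m l : ℤ} {p q : ℕ}
    (hp : i + p = m) (hq : m + q = l) (h : i + (p + q : ℕ) = l) (x : M.carrier i)
    (a : 𝒜 (p + q)) :
    M.act h x a ∈ Submodule.span k {y | ∃ (b : 𝒜 p) (c : 𝒜 q), M.act hq (M.act hp x b) c = y} := by
  -- The elements with the desired property form a subspace of `A_{p+q}`; viewed inside `A`, it only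
  -- has to contain the products generating `A_p A_q`.
  have key : 𝒜 (p + q) ≤ (Submodule.comap (M.act h x) (Submodule.span k
      {y | ∃ (b : 𝒜 p) (c : 𝒜 q), M.act hq (M.act hp x b) c = y})).map (𝒜 (p + q)).subtype := by
    conv_lhs => rw [component_add hgen]
    rw [Submodule.mul_le]
    intro b hb c hc
    refine ⟨⟨b * c, SetLike.GradedMul.mul_mem hb hc⟩, Submodule.subset_span ⟨⟨b, hb⟩, ⟨c, hc⟩, ?_⟩,
      rfl⟩
    exact M.act_mul hp hq h x ⟨b, hb⟩ ⟨c, hc⟩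
  obtain ⟨a', ha', haa'⟩ := key a.2
  obtain rfl : a' = a := Subtype.ext haa'
  exact ha'

end GrMod

end Algebra

/-! ### Veronese modules and the coherence of the Veronese algebra. -/

section VeroneseModules

variable {k : Type u} [Field k] {A : Type v} [Ring A] [Algebra k A]
  {𝒜 : ℕ → Submodule k A} [GradedAlgebra 𝒜] (n : ℕ) [NeZero n]

namespace GrMod

theorem act_congr (M : GrMod 𝒜) {i l : ℤ} {j j' : ℕ} (h : i + j = l) (h' : i + j' = l)
    (x : M.carrier i) {a : 𝒜 j} {a' : 𝒜 j'} (ha : a.1 = a'.1) :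
    M.act h x a = M.act h' x a' := by
  obtain rfl : j = j' := by omega
  rw [Subtype.ext ha]

/-- The inclusion of `(A⁽ⁿ⁾)_j` into `A_{jn}`. -/
def veroneseIncl (𝒜 : ℕ → Submodule k A) (n j : ℕ) [GradedAlgebra 𝒜] :
    veroneseGrading 𝒜 n j →ₗ[k] 𝒜 (j * n) :=
  ((veronese 𝒜 n).val.toLinearMap.comp (veroneseGrading 𝒜 n j).subtype).codRestrict _
    fun a => a.2

omit [NeZero n] in
theorem veronese_degree {i l : ℤ} {j : ℕ} (h : i + j = l) : i * n + (j * n : ℕ) = l * n := by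
  subst h; push_cast; ring

/-- The Veronese module `M⁽ⁿ⁾` over `A⁽ⁿ⁾`, with components `M_{in}`. -/
def vero (M : GrMod 𝒜) : GrMod (veroneseGrading 𝒜 n) where
  carrier i := M.carrier (i * n)
  act {_ j _} h := (M.act (veronese_degree n h)).compl₂ (veroneseIncl 𝒜 n j)
  act_one {i} h x := by
    rw [LinearMap.compl₂_apply]
    refine Eq.trans ?_ (M.act_one (by simp) x)
    exact M.act_congr _ _ x rfl
  act_mul h h' h'' x a b := by
    rw [LinearMap.compl₂_apply, LinearMap.compl₂_apply, LinearMap.compl₂_apply]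
    refine (M.act_mul _ _ ?_ x _ _).trans (M.act_congr _ _ x rfl)
    rw [← add_mul]
    exact veronese_degree n h''

/-- The homomorphism of Veronese modules induced by a homomorphism. -/
def veroMap {M N : GrMod 𝒜} (f : M ⟶ N) : vero n M ⟶ vero n N where
  app i := f.app (i * n)
  app_act h x _ := f.app_act (veronese_degree n h) x _

omit [NeZero n] in
theorem exists_veroneseIncl_eq {j : ℕ} (a : 𝒜 (j * n)) : ∃ b, veroneseIncl 𝒜 n j b = a :=
  ⟨⟨⟨a.1, mem_veronese 𝒜 n a.2⟩, a.2⟩, rfl⟩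

theorem IsFG.vero (hgen : IsGeneratedInDegreeOne 𝒜) (hfin : ∀ m, (𝒜 m).FG) {M : GrMod 𝒜}
    (hM : IsFG M) : IsFG (vero n M) := by
  obtain ⟨s, e, x, hx⟩ := hM.exists_span
  have hn : (0 : ℤ) < n := by exact_mod_cast Nat.pos_of_ne_zero (NeZero.ne n)
  -- This is the ceiling of `e t / n`: `q t * n` is the first multiple of `n` not below the degree
  -- of the generator.
  let q : Fin s → ℤ := fun t => -((-e t) / n)
  have hq : ∀ t, e t ≤ q t * n := fun t => by
    have := Int.ediv_mul_le (-e t) hn.ne'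
    simp only [q, neg_mul]
    omega
  have hq' : ∀ t i, e t ≤ i * n → q t ≤ i := fun t i h => by
    have : -i ≤ -e t / n := (Int.le_ediv_iff_mul_le hn).2 (by rw [neg_mul]; omega)
    simp only [q]
    omega
  let p : Fin s → ℕ := fun t => (q t * n - e t).toNat
  have hp : ∀ t, e t + p t = q t * n := fun t => by
    have := hq t
    simp only [p]
    omega
  refine isFG_of_span q (fun t => ((⊤ : Submodule k (𝒜 (p t))).map (M.act (hp t) (x t)) :
    Submodule k (M.carrier (q t * n)))) (fun t => ((Submodule.fg_top _).2 (hfin _)).map _)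
    fun i (T : Submodule k (M.carrier (i * n))) hT => ?_
  change T = ⊤
  rw [eq_top_iff, ← hx, Submodule.span_le]
  rintro _ ⟨t, j, hj, a, rfl⟩
  have hi := hq' t i (by omega)
  obtain ⟨r, hr⟩ := Int.eq_ofNat_of_zero_le (sub_nonneg.2 hi)
  have hr' : q t + r = i := by omega
  have hdeg := veronese_degree n hr'
  -- Every multiple of `x t` landing in a degree divisible by `n` passes through degree `q t * n`,
  -- and the rest of the way is an action of `A⁽ⁿ⁾`.
  obtain rfl : j = p t + r * n := by
    have := hp t
    omega
  refine Submodule.span_le.2 ?_ (M.act_add_mem_span hgen (hp t) hdeg hj (x t) a)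
  rintro _ ⟨b, c, rfl⟩
  obtain ⟨c', rfl⟩ := exists_veroneseIncl_eq n c
  exact hT t r hr' _ ⟨b, trivial, rfl⟩ c'

theorem IsBounded.vero {M : GrMod 𝒜} (hM : IsBounded M) : IsBounded (vero n M) := by
  have hn : (n : ℤ) ≠ 0 := by exact_mod_cast NeZero.ne n
  exact Set.Finite.preimage (f := fun i : ℤ => i * (n : ℤ)) (mul_left_injective₀ hn).injOn hM

/-- In a high degree `i`, each multiple of a generator factors through the component in the last
multiple of `n` up to `i`, which is zero. Below the degrees of the generators there is nothing. -/
theorem IsBounded.of_vero (hgen : IsGeneratedInDegreeOne 𝒜) {M : GrMod 𝒜} (hM : IsFG M)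
    (h : IsBounded (GrMod.vero n M)) : IsBounded M := by
  obtain ⟨s, e, x, hx⟩ := hM.exists_span
  have hn : (0 : ℤ) < n := by exact_mod_cast Nat.pos_of_ne_zero (NeZero.ne n)
  obtain ⟨lo, hlo⟩ := (Set.finite_range e).bddBelow
  obtain ⟨hi, hhi⟩ := (Set.finite_range e).bddAbove
  obtain ⟨b, hb⟩ := Set.Finite.bddAbove h
  -- Rounding `i` down to a multiple of `n` loses less than `n`. The first bound keeps the result
  -- above all generators, the second above the support of the Veronese module.
  refine (Set.finite_Icc lo (max (hi + n) ((b + 1) * n + n))).subset fun i hiM => ?_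
  have hMi : Nontrivial (M.carrier i) := hiM
  have hne : (⊤ : Submodule k (M.carrier i)) ≠ ⊥ := top_ne_bot
  rw [← hx, Ne, Submodule.span_eq_bot] at hne
  constructor
  · by_contra hlt
    refine hne ?_
    rintro _ ⟨t, j, hj, a, rfl⟩
    have := hlo ⟨t, rfl⟩
    omega
  · by_contra hlt
    rw [not_le, max_lt_iff] at hlt
    refine hne ?_
    rintro _ ⟨t, j, hj, a, rfl⟩
    have h1 : e t ≤ hi := hhi ⟨t, rfl⟩
    have h2 : i / n * n + i % n = i := Int.ediv_mul_add_emod i n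
    have h3 := Int.emod_lt_of_pos i hn
    have h4 := Int.emod_nonneg i hn.ne'
    obtain ⟨p, hp⟩ := Int.eq_ofNat_of_zero_le (show 0 ≤ i / n * n - e t by omega)
    obtain ⟨r, hr⟩ := Int.eq_ofNat_of_zero_le h4
    obtain rfl : j = p + r := by omega
    have hsub : Subsingleton (M.carrier (i / n * n)) := by
      by_contra hcon
      have h5 : i / n ≤ b := hb (not_subsingleton_iff_nontrivial.1 hcon)
      have h6 : i / n * n ≤ b * n := Int.mul_le_mul_of_nonneg_right h5 hn.le
      have h7 : (b + 1) * n = b * n + n := by ring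
      omega
    have := M.act_add_mem_span hgen (m := i / n * n) (p := p) (q := r) (by omega) (by omega)
      hj (x t) a
    rw [← Submodule.mem_bot k]
    refine (Submodule.span_le.2 ?_) this
    rintro _ ⟨y, z, rfl⟩
    rw [Subsingleton.elim (M.act _ (x t) y) 0]
    simp

theorem mem_comp_veronese {j : ℤ} {x : veronese 𝒜 n} :
    x ∈ comp (veroneseGrading 𝒜 n) j ↔ (x : A) ∈ comp 𝒜 (j * n) := by
  cases j with
  | ofNat j =>
    have : Int.ofNat j * (n : ℤ) = Int.ofNat (j * n) := by simp
    rw [this]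
    rfl
  | negSucc j =>
    have hn : (0 : ℤ) < n := by exact_mod_cast Nat.pos_of_ne_zero (NeZero.ne n)
    obtain ⟨c, hc⟩ := Int.eq_negSucc_of_lt_zero
      (Int.mul_neg_of_neg_of_pos (Int.negSucc_lt_zero j) hn)
    rw [hc]
    change x = 0 ↔ x.1 = 0
    exact Subtype.ext_iff

theorem mem_veronese_of_mem_comp {j : ℤ} {x : A} (hx : x ∈ comp 𝒜 (j * n)) :
    x ∈ veronese 𝒜 n := by
  cases j with
  | ofNat j =>
    have : Int.ofNat j * (n : ℤ) = Int.ofNat (j * n) := by simp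
    rw [this] at hx
    exact mem_veronese 𝒜 n hx
  | negSucc j =>
    have hn : (0 : ℤ) < n := by exact_mod_cast Nat.pos_of_ne_zero (NeZero.ne n)
    obtain ⟨c, hc⟩ := Int.eq_negSucc_of_lt_zero
      (Int.mul_neg_of_neg_of_pos (Int.negSucc_lt_zero j) hn)
    rw [hc] at hx
    obtain rfl : x = 0 := hx
    exact Subalgebra.zero_mem _

/-- The component of degree `j` of `A⁽ⁿ⁾` is the component of degree `jn` of `A`. -/
noncomputable def compEquiv {j m : ℤ} (h : j * n = m) : comp (veroneseGrading 𝒜 n) j ≃ₗ[k] comp 𝒜 m where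
  toFun x := ⟨x.1.1, by rw [← h]; exact (mem_comp_veronese n).1 x.2⟩
  map_add' _ _ := rfl
  map_smul' _ _ := rfl
  invFun y := ⟨⟨y.1, mem_veronese_of_mem_comp n (by subst h; exact y.2)⟩,
    (mem_comp_veronese n).2 (by subst h; exact y.2)⟩
  left_inv _ := rfl
  right_inv _ := rfl

@[simp]
theorem compEquiv_coe {j m : ℤ} (h : j * n = m) (x : comp (veroneseGrading 𝒜 n) j) :
    (compEquiv (𝒜 := 𝒜) n h x : A) = x.1.1 := rfl

/-- The comparison of `⨁ A⁽ⁿ⁾(d_t)` with the Veronese module of `⨁ A(n d_t)`. -/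
noncomputable def veroFree {ι : Type} (d : ι → ℤ) :
    freeOn (veroneseGrading 𝒜 n) d ⟶ vero n (freeOn 𝒜 fun t => d t * n) where
  app i :=
    { toFun := fun x => (ofCoord fun t => compEquiv (𝒜 := 𝒜) n (add_mul _ _ _) (coord t i x) :
        (freeOn 𝒜 fun t => d t * n).carrier (i * n))
      map_add' := fun _ _ => rfl
      map_smul' := fun _ _ => rfl }
  app_act _ _ _ := rfl

theorem coord_veroFree {ι : Type} (d : ι → ℤ) (i : ℤ)
    (x : (freeOn (veroneseGrading 𝒜 n) d).carrier i) (t : ι) :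
    coord (d := fun t => d t * n) t (i * n) ((veroFree (𝒜 := 𝒜) n d).app i x) =
      compEquiv (𝒜 := 𝒜) n (add_mul _ _ _) (coord t i x) := rfl

theorem veroFree_bijective {ι : Type} (d : ι → ℤ) (i : ℤ) :
    Function.Bijective ((veroFree (𝒜 := 𝒜) n d).app i) :=
  Function.bijective_iff_has_inverse.2
    ⟨fun y => ofCoord fun t => (compEquiv (𝒜 := 𝒜) n (add_mul _ _ _)).symm
      (coord (d := fun t => d t * n) t (i * n) y), fun _ => rfl, fun _ => rfl⟩

/-- Generators on the right are placed in degree `-d t * n`, not `-(d t * n)`, so that both sides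
lie in the same component without transport; this is why `gen` takes the degrees `e` as separate
data. -/
theorem veroFree_gen {ι : Type} (d : ι → ℤ) (t : ι) :
    (veroFree (𝒜 := 𝒜) n d).app (-d t) (gen (neg_add_self_apply d) t) =
      gen (e := fun t => -d t * n) (d := fun t => d t * n) (fun t => by ring) t := by
  refine freeOn_ext (d := fun t => d t * n) fun t' => ?_
  rw [coord_veroFree, compEquiv_coe]
  by_cases ht : t' = t
  · subst ht
    exact (congrArg (fun z => (z.1.1 : A))
      (coord_gen_same (𝒜 := veroneseGrading 𝒜 n) (neg_add_self_apply d) t')).trans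
      (congrArg Subtype.val (coord_gen_same (𝒜 := 𝒜) (e := fun t => -d t * n)
        (d := fun t => d t * n) (fun t => by ring) t')).symm
  · exact (congrArg (fun z => (z.1.1 : A))
      (coord_gen_ne (𝒜 := veroneseGrading 𝒜 n) (neg_add_self_apply d) ht)).trans
      (congrArg Subtype.val (coord_gen_ne (𝒜 := 𝒜) (e := fun t => -d t * n)
        (d := fun t => d t * n) (fun t => by ring) ht)).symm

variable {n} {ι : Type} [Fintype ι] {d : ι → ℤ}

/-- A map `A⁽ⁿ⁾(d) → M⁽ⁿ⁾` and a map `A(dn) → M` are both given by an element of `M_{-dn}`. -/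
theorem exists_veroFree_lift {M : GrMod 𝒜} (φ : freeOn (veroneseGrading 𝒜 n) d ⟶ vero n M) :
    ∃ ψ : (freeOn 𝒜 fun t => d t * n) ⟶ M, veroFree (𝒜 := 𝒜) n d ≫ veroMap n ψ = φ := by
  let x : ∀ t, M.carrier (-d t * n) := fun t => φ.app (-d t) (gen (neg_add_self_apply d) t)
  refine ⟨freeLift (e := fun t => -d t * n) (d := fun t => d t * n) (fun t => by ring) x,
    freeOn_hom_ext (neg_add_self_apply d) fun t => ?_⟩
  rw [comp_app, veroFree_gen]
  exact freeLift_gen (e := fun t => -d t * n) (d := fun t => d t * n) _ x t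

theorem veroFree_lift_unique {M : GrMod 𝒜} {ψ ψ' : (freeOn 𝒜 fun t => d t * n) ⟶ M}
    (h : veroFree (𝒜 := 𝒜) n d ≫ veroMap n ψ = veroFree (𝒜 := 𝒜) n d ≫ veroMap n ψ') :
    ψ = ψ' := by
  refine freeOn_hom_ext (e := fun t => -d t * n) (d := fun t => d t * n) (fun t => by ring)
    fun t => ?_
  rw [← veroFree_gen]
  have := congrArg (fun g => Hom.app g (-d t) (gen (neg_add_self_apply d) t)) h
  exact this

variable (n)

/-- A map from a free `A⁽ⁿ⁾`-module lifts to `ψ` over `A`, and its kernel is the Veronese module of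
`ker ψ`, which `IsFG.vero` covers. -/
theorem IsCoherent.vero (hgen : IsGeneratedInDegreeOne 𝒜) (hfin : ∀ m, (𝒜 m).FG) {M : GrMod 𝒜}
    (hM : IsCoherent M) : IsCoherent (vero n M) := by
  refine ⟨hM.1.vero n hgen hfin, fun s d φ => ?_⟩
  obtain ⟨ψ, rfl⟩ : ∃ ψ : (freeOn 𝒜 fun t => d t * n) ⟶ M,
    veroFree (𝒜 := 𝒜) n d ≫ veroMap n ψ = φ := exists_veroFree_lift φ
  have hb := veroFree_bijective (𝒜 := 𝒜) n d
  let E := isoOfBijective (veroFree (𝒜 := 𝒜) n d) hb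
  refine isFG_ker_of_exact ((hM.isFG_ker_freeOn ψ).vero n hgen hfin)
    (veroMap n (kerι ψ) ≫ E.inv) (veroFree (𝒜 := 𝒜) n d ≫ veroMap n ψ)
    fun i x => ?_
  have h1 : ∀ y, (veroFree (𝒜 := 𝒜) n d).app i (E.inv.app i y) = y := fun y => by
    rw [← comp_app]
    change Hom.app (E.inv ≫ E.hom) i y = y
    rw [E.inv_hom_id, id_app]
  constructor
  · intro hx
    refine ⟨⟨(veroFree (𝒜 := 𝒜) n d).app i x, hx⟩, (hb i).1 (h1 _)⟩
  · rintro ⟨y, rfl⟩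
    exact (congrArg (ψ.app (i * n)) (h1 _)).trans y.2

/-- The comparison of `A⁽ⁿ⁾(j)` with the Veronese module of `A(nj)`. -/
noncomputable def veroRegular (𝒜 : ℕ → Submodule k A) [GradedAlgebra 𝒜] (j : ℤ) :
    (regular (veroneseGrading 𝒜 n)).twist j ⟶ vero n ((regular 𝒜).twist (j * n)) where
  app i := (compEquiv (𝒜 := 𝒜) n (add_mul i j n)).toLinearMap
  app_act _ _ _ := rfl

/-- The action on simple modules is defined through this projection, so its compatibility gives the
linearity of `veroSimple`. -/
theorem coe_proj_zero (x : veronese 𝒜 n) :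
    (GradedAlgebra.proj (veroneseGrading 𝒜 n) 0 x : A) = GradedAlgebra.proj 𝒜 0 (x : A) := by
  refine Submodule.iSup_induction (veroneseGrading 𝒜 n)
    (motive := fun x => (GradedAlgebra.proj (veroneseGrading 𝒜 n) 0 x : A) =
      GradedAlgebra.proj 𝒜 0 (x : A))
    ((veroneseGrading_isInternal 𝒜 n).submodule_iSup_eq_top.ge Submodule.mem_top)
    (fun i y hy => ?_) ?_ fun y z hy hz => ?_
  · have hy' : (y : A) ∈ 𝒜 (i * n) := hy
    rw [GradedAlgebra.proj_apply, GradedAlgebra.proj_apply]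
    by_cases hi : i = 0
    · subst hi
      rw [decompose_of_mem_same _ hy]
      rw [zero_mul] at hy'
      rw [decompose_of_mem_same _ hy']
    · rw [decompose_of_mem_ne _ hy hi, decompose_of_mem_ne _ hy' (mul_ne_zero hi (NeZero.ne n))]
      rfl
  · simp
  · rw [map_add, Subalgebra.coe_add, hy, hz, Subalgebra.coe_add, map_add]

theorem mem_simpleComp_veronese {j i : ℤ} {x : veronese 𝒜 n} :
    x ∈ simpleComp (veroneseGrading 𝒜 n) j i ↔ (x : A) ∈ simpleComp 𝒜 (j * n) (i * n) := by
  have hn : (n : ℤ) ≠ 0 := by exact_mod_cast NeZero.ne n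
  unfold simpleComp
  by_cases h : i = j
  · rw [if_pos h, if_pos (by rw [h])]
    change (x : A) ∈ 𝒜 (0 * n) ↔ _
    rw [zero_mul]
  · rw [if_neg h, if_neg fun h' => h (mul_right_cancel₀ hn h')]
    exact Subtype.ext_iff

/-- The comparison of the simple module over `A⁽ⁿ⁾` concentrated in degree `j` with the Veronese
module of the simple module over `A` concentrated in degree `nj`. -/
noncomputable def veroSimple (𝒜 : ℕ → Submodule k A) [GradedAlgebra 𝒜] (j : ℤ) :
    simple (veroneseGrading 𝒜 n) j ⟶ vero n (simple 𝒜 (j * n)) where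
  app i :=
    { toFun := fun x => (⟨x.1.1, (mem_simpleComp_veronese n).1 x.2⟩ :
        simpleComp 𝒜 (j * n) (i * n))
      map_add' := fun _ _ => rfl
      map_smul' := fun _ _ => rfl }
  app_act _ x a := Subtype.ext (coe_proj_zero n (x.1 * a.1))

theorem veroSimple_bijective (j i : ℤ) : Function.Bijective ((veroSimple n 𝒜 j).app i) := by
  refine ⟨fun x y h => Subtype.ext (Subtype.ext
    (congrArg (fun z : simpleComp 𝒜 (j * n) (i * n) => z.1) h)), fun y => ?_⟩
  have hmem : y.1 ∈ 𝒜 (0 * n) := by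
    have h1 := y.2
    rw [zero_mul]
    by_cases h : i * (n : ℤ) = j * n
    · have h2 : simpleComp 𝒜 (j * n) (i * n) = 𝒜 0 := if_pos h
      exact h2.le h1
    · have h2 : simpleComp 𝒜 (j * n) (i * n) = ⊥ := if_neg h
      have h3 : y.1 = 0 := h2.le h1
      rw [h3]
      exact Submodule.zero_mem _
  exact ⟨⟨⟨y.1, mem_veronese 𝒜 n hmem⟩, (mem_simpleComp_veronese n).2 y.2⟩, rfl⟩

end GrMod

open GrMod

theorem isCoherentAlgebra_veronese (hconn : IsConnected 𝒜) (hgen : IsGeneratedInDegreeOne 𝒜)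
    (hcoh : IsCoherentAlgebra 𝒜) : IsCoherentAlgebra (veroneseGrading 𝒜 n) := by
  have hfin := fg_component hconn (hcoh.2 0)
  refine ⟨fun j => ?_, fun j => ?_⟩
  · exact ((hcoh.1 (j * n)).vero n hgen hfin).of_iso
      (isoOfBijective (veroRegular n 𝒜 j) fun i => (compEquiv (𝒜 := 𝒜) n (add_mul i j n)).bijective).symm
  · exact ((hcoh.2 (j * n)).vero n hgen hfin).of_iso
      (isoOfBijective (veroSimple n 𝒜 j) (veroSimple_bijective n j)).symm

end VeroneseModules

/-! ### Left adjoints from universal isomorphisms. -/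

section Adjoint

/-- A functor `G` such that each object `X` has a universal arrow `X ⟶ G.obj Y` which is an
isomorphism has a fully faithful left adjoint. -/
theorem exists_adjunction_of_universal_iso {C : Type*} {D : Type*} [Category* C] [Category* D]
    (G : D ⥤ C) (h : ∀ X : C, ∃ (Y : D) (η : X ≅ G.obj Y), ∀ (Y' : D) (φ : X ⟶ G.obj Y'),
      ∃! ψ : Y ⟶ Y', η.hom ≫ G.map ψ = φ) :
    ∃ (L : C ⥤ D) (adj : L ⊣ G), IsIso adj.unit := by
  choose Y η hη using h
  let e : ∀ X Y', (Y X ⟶ Y') ≃ (X ⟶ G.obj Y') := fun X Y' =>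
    Equiv.ofBijective (fun ψ => (η X).hom ≫ G.map ψ)
      ((Function.bijective_iff_existsUnique _).2 (hη X Y'))
  have he : ∀ X Y Y' g h, e X Y' (h ≫ g) = e X Y h ≫ G.map g := fun X Y Y' g h => by simp [e]
  refine ⟨_, Adjunction.adjunctionOfEquivLeft e he, ?_⟩
  have : ∀ X, IsIso ((Adjunction.adjunctionOfEquivLeft e he).unit.app X) := fun X => by
    have : (Adjunction.adjunctionOfEquivLeft e he).unit.app X = (η X).hom := by
      simp [e]
    rw [this]
    infer_instance
  exact NatIso.isIso_of_isIso_app _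

end Adjoint

/-! ### The equivalence of the quotient categories. -/

section Equivalence

variable {k : Type u} [Field k] {A : Type v} [Ring A] [Algebra k A]
  {𝒜 : ℕ → Submodule k A} [GradedAlgebra 𝒜]

open GrMod

theorem GrMod.nontrivial_ker_iff {M N : GrMod 𝒜} (f : M ⟶ N) (i : ℤ) :
    Nontrivial ((ker f).carrier i) ↔ ¬ Function.Injective (f.app i) := by
  rw [← LinearMap.ker_eq_bot]
  exact Submodule.nontrivial_iff_ne_bot

theorem GrMod.nontrivial_coker_iff {M N : GrMod 𝒜} (f : M ⟶ N) (i : ℤ) :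
    Nontrivial ((coker f).carrier i) ↔ ¬ Function.Surjective (f.app i) := by
  rw [← LinearMap.range_eq_top]
  exact Submodule.Quotient.nontrivial_iff

theorem GrMod.isBounded_ker_and_coker_iff {M N : GrMod 𝒜} (f : M ⟶ N) :
    IsBounded (ker f) ∧ IsBounded (coker f) ↔
      {i : ℤ | ¬ Function.Bijective (f.app i)}.Finite := by
  have : {i : ℤ | ¬ Function.Bijective (f.app i)} =
      {i : ℤ | Nontrivial ((ker f).carrier i)} ∪ {i : ℤ | Nontrivial ((coker f).carrier i)} := by
    ext i
    simp only [Set.mem_ofPred_eq, Set.mem_union, nontrivial_ker_iff, nontrivial_coker_iff,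
      Function.Bijective, not_and_or]
  rw [this, Set.finite_union]
  rfl

/-- Kernel and cokernel of a map of coherent modules are automatically coherent, so only boundedness
is a condition. -/
theorem isoModBounded_iff {X Y : Coh 𝒜} (f : X ⟶ Y) :
    isoModBounded 𝒜 f ↔ {i : ℤ | ¬ Function.Bijective (f.hom.app i)}.Finite := by
  rw [← isBounded_ker_and_coker_iff]
  exact ⟨fun h => ⟨h.1.2, h.2.2⟩, fun h =>
    ⟨⟨X.property.ker Y.property f.hom, h.1⟩, ⟨.coker X.property.1 Y.property f.hom, h.2⟩⟩⟩

theorem isoModBounded_of_isIso {X Y : Coh 𝒜} (f : X ⟶ Y) [IsIso f] : isoModBounded 𝒜 f := by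
  rw [isoModBounded_iff]
  convert Set.finite_empty
  ext i
  simp [bijective_app_of_isIso f.hom i]

instance : (isoModBounded 𝒜).RespectsIso := by
  refine MorphismProperty.RespectsIso.mk _ (fun e f hf => ?_) fun e f hf => ?_
  · rw [isoModBounded_iff] at hf ⊢
    refine hf.subset fun i hi hi' => hi ?_
    exact hi'.comp (bijective_app_of_isIso e.hom.hom i)
  · rw [isoModBounded_iff] at hf ⊢
    refine hf.subset fun i hi hi' => hi ?_
    exact (bijective_app_of_isIso e.hom.hom i).comp hi'

variable (n : ℕ) [NeZero n]

/-- The zero homomorphism. -/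
def GrMod.zeroHom (M N : GrMod 𝒜) : M ⟶ N where
  app _ := 0
  app_act _ _ _ := by simp

/-- Each coherent module over `A⁽ⁿ⁾` has a universal homomorphism to a Veronese module of a coherent
module over `A`, and it is bijective. -/
theorem exists_universal_vero (hcoh : IsCoherentAlgebra 𝒜) {N : GrMod (veroneseGrading 𝒜 n)}
    (hN : IsCoherent N) : ∃ (M : GrMod 𝒜) (_ : IsCoherent M) (η : N ⟶ vero n M)
      (_ : ∀ i, Function.Bijective (η.app i)), ∀ (M' : GrMod 𝒜) (φ : N ⟶ vero n M'),
        ∃! ψ : M ⟶ M', η ≫ veroMap n ψ = φ := by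
  obtain ⟨s, d, π, hπ⟩ : ∃ (s : ℕ) (d : Fin s → ℤ) (π : freeOn (veroneseGrading 𝒜 n) d ⟶ N),
    ∀ i, Function.Surjective (π.app i) := hN.1
  obtain ⟨r, e, q, hq⟩ : ∃ (r : ℕ) (e : Fin r → ℤ)
    (q : freeOn (veroneseGrading 𝒜 n) e ⟶ ker π), ∀ i, Function.Surjective (q.app i) :=
    hN.isFG_ker_freeOn π
  -- The presentation of `N` by free `A⁽ⁿ⁾`-modules lifts to a map `g` of free `A`-modules. Its
  -- cokernel, which plays the role of `N ⊗ A` over `A⁽ⁿ⁾`, is the universal object.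
  obtain ⟨g, hg⟩ := exists_veroFree_lift (q ≫ kerι π ≫ veroFree (𝒜 := 𝒜) n d)
  have hg' : ∀ i x, g.app (i * n) ((veroFree (𝒜 := 𝒜) n e).app i x) =
      (veroFree (𝒜 := 𝒜) n d).app i ((kerι π).app i (q.app i x)) := fun i x =>
    congrArg (fun h => Hom.app h i x) hg
  have hzero : ∀ i x, (veroFree (𝒜 := 𝒜) n d ≫ veroMap n (cokerπ g)).app i x = 0 ↔
      π.app i x = 0 := by
    intro i x
    refine (cokerπ_app_eq_zero g (i * n) _).trans ⟨?_, fun hx => ?_⟩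
    · rintro ⟨y, hy⟩
      obtain ⟨z, rfl⟩ := (veroFree_bijective (𝒜 := 𝒜) n e i).2 y
      have := (veroFree_bijective (𝒜 := 𝒜) n d i).1 ((hg' i z).symm.trans hy)
      rw [← this]
      exact kerι_app_mem π i _
    · obtain ⟨z, hz⟩ := hq i ⟨x, hx⟩
      refine ⟨(veroFree (𝒜 := 𝒜) n e).app i z, (hg' i z).trans ?_⟩
      rw [hz]
      rfl
  obtain ⟨η, hη⟩ := exists_factor π hπ (veroFree (𝒜 := 𝒜) n d ≫ veroMap n (cokerπ g))
    fun i x => (hzero i x).2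
  have hη' : ∀ i x, η.app i (π.app i x) =
      (veroFree (𝒜 := 𝒜) n d ≫ veroMap n (cokerπ g)).app i x := fun i x =>
    congrArg (fun h => Hom.app h i x) hη
  have hsurj : ∀ i, Function.Surjective
      ((veroFree (𝒜 := 𝒜) n d ≫ veroMap n (cokerπ g)).app i) := fun i =>
    (cokerπ_surjective g (i * n)).comp (veroFree_bijective (𝒜 := 𝒜) n d i).2
  refine ⟨coker g, .coker (isFG_freeOn _) (isCoherent_free hcoh.1 _) g, η, fun i => ⟨?_, ?_⟩,
    fun M' φ => ?_⟩
  · rw [injective_iff_map_eq_zero]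
    intro y hy
    obtain ⟨x, rfl⟩ := hπ i y
    rwa [hη', hzero] at hy
  · intro y
    obtain ⟨x, hx⟩ := hsurj i y
    exact ⟨π.app i x, (hη' i x).trans hx⟩
  · obtain ⟨ψ, hψ⟩ := exists_veroFree_lift (π ≫ φ)
    have hψ' : ∀ i x, ψ.app (i * n) ((veroFree (𝒜 := 𝒜) n d).app i x) =
        φ.app i (π.app i x) := fun i x => congrArg (fun h => Hom.app h i x) hψ
    -- Vanishing on the Veronese part suffices, because the generators of the source of `g` lie in
    -- degrees divisible by `n`.
    have hgψ : g ≫ ψ = zeroHom _ _ := veroFree_lift_unique <| hom_ext fun i x =>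
      (congrArg (ψ.app (i * n)) (hg' i x)).trans <| (hψ' i _).trans <|
        (congrArg (φ.app i) (kerι_app_mem π i (q.app i x))).trans (map_zero _)
    obtain ⟨θ, hθ⟩ := exists_factor (cokerπ g) (cokerπ_surjective g) ψ fun i x hx => by
      obtain ⟨y, rfl⟩ := (cokerπ_app_eq_zero g i x).1 hx
      exact congrArg (fun h => Hom.app h i y) hgψ
    have hθ' : ∀ i x, θ.app i ((cokerπ g).app i x) = ψ.app i x := fun i x =>
      congrArg (fun h => Hom.app h i x) hθ
    refine ⟨θ, cancel_surjective π hπ <| hom_ext fun i x => ?_, fun θ' h => ?_⟩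
    · exact (congrArg (θ.app (i * n)) (hη' i x)).trans <| (hθ' _ _).trans (hψ' i x)
    · refine cancel_surjective (cokerπ g) (cokerπ_surjective g) (Eq.trans ?_ hθ.symm)
      refine veroFree_lift_unique <| hom_ext fun i x => ?_
      exact (congrArg (θ'.app (i * n)) (hη' i x).symm).trans <|
        (congrArg (fun h => Hom.app h i (π.app i x)) h).trans (hψ' i x).symm

/-- The Veronese functor between the categories of coherent modules. -/
noncomputable def cohVero (hgen : IsGeneratedInDegreeOne 𝒜) (hfin : ∀ m, (𝒜 m).FG) :
    Coh 𝒜 ⥤ Coh (veroneseGrading 𝒜 n) where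
  obj X := ⟨vero n X.obj, X.property.vero n hgen hfin⟩
  map f := ObjectProperty.homMk (veroMap n f.hom)

theorem isoModBounded_cohVero_iff (hgen : IsGeneratedInDegreeOne 𝒜)
    (hfin : ∀ m, (𝒜 m).FG) {X Y : Coh 𝒜} (f : X ⟶ Y) :
    isoModBounded (veroneseGrading 𝒜 n) ((cohVero n hgen hfin).map f) ↔ isoModBounded 𝒜 f := by
  rw [isoModBounded_iff, isoModBounded_iff, ← isBounded_ker_and_coker_iff,
    ← isBounded_ker_and_coker_iff]
  have hk := X.property.ker Y.property f.hom
  have hc := IsCoherent.coker X.property.1 Y.property f.hom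
  -- The components of the kernel and cokernel of `veroMap n f` are by definition those of `ker f`
  -- and `coker f` in degrees `in`.
  exact ⟨fun h => ⟨.of_vero n hgen hk.1 h.1, .of_vero n hgen hc.1 h.2⟩,
    fun h => ⟨h.1.vero n, h.2.vero n⟩⟩

theorem exists_adjunction_cohVero (hgen : IsGeneratedInDegreeOne 𝒜)
    (hfin : ∀ m, (𝒜 m).FG) (hcoh : IsCoherentAlgebra 𝒜) :
    ∃ (L : Coh (veroneseGrading 𝒜 n) ⥤ Coh 𝒜) (adj : L ⊣ cohVero n hgen hfin),
      IsIso adj.unit := by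
  refine exists_adjunction_of_universal_iso _ fun N => ?_
  obtain ⟨M, hM, η, hη, huniv⟩ := exists_universal_vero n hcoh N.property
  refine ⟨⟨M, hM⟩, ObjectProperty.isoMk _ (isoOfBijective η hη), fun M' φ => ?_⟩
  obtain ⟨ψ, hψ, hψ'⟩ := huniv M'.obj φ.hom
  exact ⟨ObjectProperty.homMk ψ, ObjectProperty.hom_ext _ hψ, fun θ hθ =>
    ObjectProperty.hom_ext _ (hψ' θ.hom (congrArg (fun h => h.hom) hθ))⟩

theorem nonempty_cohProj_equivalence (hgen : IsGeneratedInDegreeOne 𝒜)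
    (hfin : ∀ m, (𝒜 m).FG) (hcoh : IsCoherentAlgebra 𝒜) :
    Nonempty (CohProj 𝒜 ≌ CohProj (veroneseGrading 𝒜 n)) := by
  let V := cohVero n hgen hfin
  let W := isoModBounded (veroneseGrading 𝒜 n)
  obtain ⟨L, adj, hadj⟩ := exists_adjunction_cohVero n hgen hfin hcoh
  have := adj.fullyFaithfulLOfIsIsoUnit.full
  have := adj.fullyFaithfulLOfIsIsoUnit.faithful
  -- A right adjoint of a fully faithful functor is the localization at the morphisms it inverts.
  have hV : V.IsLocalization ((MorphismProperty.isomorphisms _).inverseImage V) :=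
    adj.isLocalization'
  have hVQ : (V ⋙ W.Q).IsLocalization (isoModBounded 𝒜) := by
    refine Functor.IsLocalization.comp V W.Q
      ((MorphismProperty.isomorphisms _).inverseImage V) W (isoModBounded 𝒜) ?_ ?_ ?_
    · intro X Y f hf
      exact Localization.inverts W.Q W _ ((isoModBounded_cohVero_iff n hgen hfin f).2 hf)
    · intro X Y f hf
      have : IsIso (V.map f) := hf
      exact (isoModBounded_cohVero_iff n hgen hfin f).1 (isoModBounded_of_isIso _)
    -- By the unit isomorphism `g` is isomorphic to `V.map (L.map g)`, so every morphism of `W`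
    -- comes, up to isomorphism, from one of `isoModBounded 𝒜`.
    · intro X Y g hg
      have e : Arrow.mk g ≅ Arrow.mk (V.map (L.map g)) :=
        Arrow.isoMk ((asIso adj.unit).app X) ((asIso adj.unit).app Y)
          (adj.unit.naturality g).symm
      rw [((isoModBounded 𝒜).map V).arrow_mk_iso_iff e]
      refine MorphismProperty.map_mem_map _ _ _ ?_
      rw [← isoModBounded_cohVero_iff n hgen hfin]
      exact (W.arrow_mk_iso_iff e).1 hg
  exact ⟨Localization.uniq (isoModBounded 𝒜).Q (V ⋙ W.Q) (isoModBounded 𝒜)⟩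

end Equivalence

end GradedCoherence

theorem mainTheorem3 {k : Type u} [Field k] {A : Type v} [Ring A] [Algebra k A]
    (𝒜 : ℕ → Submodule k A) [GradedAlgebra 𝒜]
    (hconn : GradedCoherence.IsConnected 𝒜)
    (hgen : GradedCoherence.IsGeneratedInDegreeOne 𝒜)
    (hcoh : GradedCoherence.IsCoherentAlgebra 𝒜)
    (n : ℕ) [NeZero n] :
    GradedCoherence.IsCoherentAlgebra (GradedCoherence.veroneseGrading 𝒜 n) ∧
      Nonempty (GradedCoherence.CohProj 𝒜 ≌
        GradedCoherence.CohProj (GradedCoherence.veroneseGrading 𝒜 n)) :=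
  ⟨GradedCoherence.isCoherentAlgebra_veronese n hconn hgen hcoh,
    GradedCoherence.nonempty_cohProj_equivalence n hgen
      (GradedCoherence.fg_component hconn (hcoh.2 0)) hcoh⟩
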